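/- For every $R>0$ there is a constant $\beta=\beta(R)$, depending only on $R$, such that the following holds. Let $V\in L^\infty(\mathbb R)$ be real-valued with $\|V\|_\infty\le R$ (essential supremum), and let $H=-\frac{d^2}{dx^2}+V$ be the self-adjoint Schrödinger operator on $L^2(\mathbb R)$ with domain the Sobolev space $H^2(\mathbb R)$; let $e^{-iHt}$, $t\in\mathbb R$, be its unitary group. Let $X^2$ denote multiplication by $x^2$ with domain $D(X^2)=\{\psi\in L^2(\mathbb R): x^2\psi\in L^2(\mathbb R)\}$. Then for every $\psi\in H^2(\mathbb R)\cap D(X^2)$ and every $t\in\mathbb R$ one has $e^{-iHt}\psi\in D(X^2)$ and $$\|X^2e^{-iHt}\psi\|\le \beta\,(1+t^2)\,\bigl(\|\psi\|_{H^2(\mathbb R)}^2+\|X^2\psi\|^2\bigr)^{1/2},$$ where $\|\cdot\|$ is the $L^2(\mathbb R)$ norm and $\|\psi\|_{H^2(\mathbb R)}^2=\|\psi\|^2+\|\psi'\|^2+\|\psi''\|^2$, with weak derivatives. -/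

import Mathlib

open MeasureTheory
open scoped ENNReal

namespace Schrodinger

section

open Filter Topology SchwartzMap LineDeriv FourierTransform

/-- The Hilbert space `L²(ℝ)` of complex-valued functions. -/
abbrev L2R : Type := Lp ℂ 2 (volume : Measure ℝ)

/-! ### Unitary groups and their generators -/

section Abstract

variable {E : Type*} [NormedAddCommGroup E] [InnerProductSpace ℂ E]

/-- `U` is the strongly continuous one-parameter unitary group `t ↦ e^{-itA}` generated by the
unbounded operator `A`: a group of isometries of `E`, hence of unitary operators, such that `ψ` lies
in the domain of `A` with `A ψ = φ` if and only if `t ↦ U t ψ` is differentiable at `0` with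
derivative `-iφ`. -/
structure IsUnitaryGroup (A : E →ₗ.[ℂ] E) (U : ℝ → E →L[ℂ] E) : Prop where
  zero : U 0 = 1
  add : ∀ s t : ℝ, U (s + t) = U s * U t
  norm_map : ∀ (t : ℝ) (ψ : E), ‖U t ψ‖ = ‖ψ‖
  cont : ∀ ψ : E, Continuous fun t : ℝ => U t ψ
  generator : ∀ ψ φ : E,
    (ψ, φ) ∈ A.graph ↔ HasDerivAt (fun t : ℝ => U t ψ) (-(Complex.I • φ)) 0

theorem continuous_apply_of_norm_map {U : ℝ → E →L[ℂ] E} (hn : ∀ (t : ℝ) (ψ : E), ‖U t ψ‖ = ‖ψ‖)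
    (hc : ∀ ψ : E, Continuous fun t : ℝ => U t ψ) {w : ℝ → E} (hw : Continuous w) :
    Continuous fun t => U t (w t) := by
  rw [continuous_iff_continuousAt]
  intro t
  have h1 : Tendsto (fun s => U s (w s - w t) + U s (w t)) (𝓝 t) (𝓝 (0 + U t (w t))) := by
    refine Tendsto.add ?_ ((hc _).tendsto t)
    rw [tendsto_zero_iff_norm_tendsto_zero]
    simp only [hn]
    have := (hw.tendsto t).sub_const (w t)
    rw [sub_self] at this
    simpa using this.norm
  simpa [ContinuousAt] using h1

theorem exists_linear_ode [CompleteSpace E] {K : ℝ → E →L[ℂ] E} {C : ℝ} (hC : 0 ≤ C) (hK : ∀ s, ‖K s‖ ≤ C)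
    (hc : ∀ w : ℝ → E, Continuous w → Continuous fun s => K s (w s)) (ψ : E) :
    ∃ w : ℝ → E, w 0 = ψ ∧ ∀ t, HasDerivAt w (K t (w t)) t := by
  let d : ℕ → ℝ → E := fun n => Nat.rec (fun _ => ψ) (fun _ f t => ∫ s in (0 : ℝ)..t, K s (f s)) n
  have d0 : d 0 = fun _ => ψ := rfl
  have ds : ∀ n, d (n + 1) = fun t => ∫ s in (0 : ℝ)..t, K s (d n s) := fun n => rfl
  have hcd : ∀ n, Continuous (d n) := by
    intro n
    induction n with
    | zero => exact continuous_const
    | succ n ih =>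
      rw [ds]
      exact intervalIntegral.continuous_primitive (fun a b => (hc _ ih).intervalIntegrable a b) 0
  have hdd : ∀ n t, HasDerivAt (d (n + 1)) (K t (d n t)) t := by
    intro n t
    rw [ds]
    exact (hc _ (hcd n)).integral_hasStrictDerivAt 0 t |>.hasDerivAt
  have hb : ∀ n t, ‖d n t‖ ≤ (C * |t|) ^ n / n.factorial * ‖ψ‖ := by
    intro n
    induction n with
    | zero => intro t; simp [d0]
    | succ n ih =>
      intro t
      rw [ds]
      have h1 : ∀ s, ‖K s (d n s)‖ ≤ C ^ (n + 1) / n.factorial * ‖ψ‖ * |s - 0| ^ n := by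
        intro s
        calc ‖K s (d n s)‖ ≤ C * ((C * |s|) ^ n / n.factorial * ‖ψ‖) :=
              (K s).le_of_opNorm_le_of_le (hK s) (ih s)
          _ = _ := by rw [sub_zero, mul_pow]; ring
      have h2 := intervalIntegral.norm_integral_le_of_norm_le_const (f := fun s => K s (d n s))
        (a := 0) (b := t) (C := 0)
      calc ‖∫ s in (0 : ℝ)..t, K s (d n s)‖ ≤ ∫ s in Set.uIoc 0 t, ‖K s (d n s)‖ :=
            intervalIntegral.norm_integral_le_integral_norm_uIoc
        _ ≤ ∫ s in Set.uIoc 0 t, C ^ (n + 1) / n.factorial * ‖ψ‖ * |s - 0| ^ n := by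
            apply setIntegral_mono
            · exact ((hc _ (hcd n)).norm.intervalIntegrable 0 t).def'
            · exact (Continuous.intervalIntegrable (by fun_prop) 0 t).def'
            · exact h1
        _ = _ := by
            rw [integral_const_mul, integral_pow_abs_sub_uIoc, sub_zero, mul_pow, Nat.factorial_succ]
            push_cast
            field_simp
  have hsum : ∀ T : ℝ, Summable fun n : ℕ => C * ((C * T) ^ n / n.factorial * ‖ψ‖) := fun T =>
    ((Real.summable_pow_div_factorial (C * T)).mul_right _).mul_left _
  have hsd : ∀ t, Summable fun n => d n t := fun t =>
    Summable.of_norm_bounded ((Real.summable_pow_div_factorial (C * |t|)).mul_right _) (hb · t)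
  refine ⟨fun t => ∑' n, d n t, ?_, ?_⟩
  · change ∑' n, d n 0 = ψ
    refine (tsum_eq_single 0 fun n hn => ?_).trans rfl
    obtain ⟨m, rfl⟩ := Nat.exists_eq_succ_of_ne_zero hn
    simp [ds]
  · intro t
    have heq : (fun t => ∑' n, d n t) = fun t => ψ + ∑' n, d (n + 1) t := by
      funext t
      rw [(hsd t).tsum_eq_zero_add, d0]
    have hder : HasDerivAt (fun t => ∑' n, d (n + 1) t) (∑' n, K t (d n t)) t := by
      refine hasDerivAt_tsum_of_isPreconnected (t := Metric.ball 0 (|t| + 1)) (y₀ := 0)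
        (hsum (|t| + 1)) Metric.isOpen_ball (convex_ball _ _).isPreconnected
        (fun n y _ => hdd n y) ?_ ?_ ?_ ?_
      · intro n y hy
        have hy' : |y| ≤ |t| + 1 := by simpa using (Metric.mem_ball.1 hy).le
        refine (K y).le_of_opNorm_le_of_le (hK y) ((hb n y).trans ?_)
        gcongr
      · simp; positivity
      · exact (summable_nat_add_iff 1).2 (hsd 0)
      · simp
    rw [← (K t).map_tsum (hsd t)] at hder
    have h2 := hder.const_add ψ
    rwa [← heq] at h2

theorem linear_ode_unique {K : ℝ → E →L[ℂ] E} {C : ℝ} (hK : ∀ s, ‖K s‖ ≤ C)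
    {v w : ℝ → E} (hv : ∀ t, HasDerivAt v (K t (v t)) t) (hw : ∀ t, HasDerivAt w (K t (w t)) t)
    (h0 : v 0 = w 0) : v = w := by
  refine ODE_solution_unique_univ (v := fun t x => K t x) (s := fun _ => Set.univ)
    (K := C.toNNReal) (t₀ := 0) ?_ (fun t => ⟨hv t, trivial⟩) (fun t => ⟨hw t, trivial⟩) h0
  intro t
  refine (LipschitzWith.weaken (K t).lipschitz ?_).lipschitzOnWith
  exact NNReal.le_toNNReal_of_coe_le (hK t)

/-- Bounded symmetric perturbations of a generator generate. -/
theorem exists_isUnitaryGroup_of_bounded_perturbation [CompleteSpace E] {A₀ A : E →ₗ.[ℂ] E} {U₀ : ℝ → E →L[ℂ] E}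
    (h₀ : IsUnitaryGroup A₀ U₀) (B : E →L[ℂ] E) (hB : ∀ x y, inner ℂ (B x) y = inner ℂ x (B y))
    (hA : ∀ ψ φ : E, (ψ, φ) ∈ A.graph ↔ (ψ, φ - B ψ) ∈ A₀.graph) :
    ∃ U : ℝ → E →L[ℂ] E, IsUnitaryGroup A U := by
  have hinv : ∀ t (x : E), U₀ (-t) (U₀ t x) = x := fun t x => by
    rw [← mul_apply_eq_comp, ← h₀.add]; simp [h₀.zero]
  have hinv' : ∀ t (x : E), U₀ t (U₀ (-t) x) = x := fun t x => by
    rw [← mul_apply_eq_comp, ← h₀.add]; simp [h₀.zero]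
  have hin : ∀ t (x y : E), inner ℂ (U₀ t x) (U₀ t y) = inner ℂ x y := fun t x y =>
    (⟨(U₀ t).toLinearMap, h₀.norm_map t⟩ : E →ₗᵢ[ℂ] E).inner_map_map x y
  let K : ℝ → E →L[ℂ] E := fun s => (-Complex.I) • ((U₀ (-s)).comp (B.comp (U₀ s)))
  have K_apply : ∀ s x, K s x = -(Complex.I • U₀ (-s) (B (U₀ s x))) := fun s x => by simp [K]
  have hK : ∀ s, ‖K s‖ ≤ ‖B‖ := by
    intro s
    refine ContinuousLinearMap.opNorm_le_bound _ (norm_nonneg _) fun x => ?_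
    rw [K_apply, norm_neg, norm_smul, Complex.norm_I, one_mul, h₀.norm_map]
    exact (B.le_opNorm _).trans_eq (by rw [h₀.norm_map])
  have hKc : ∀ w : ℝ → E, Continuous w → Continuous fun s => K s (w s) := by
    intro w hw
    simp only [K_apply]
    have h1 := B.continuous.comp (continuous_apply_of_norm_map h₀.norm_map h₀.cont hw)
    have h2 := continuous_apply_of_norm_map (U := fun s => U₀ (-s)) (fun t => h₀.norm_map _)
      (fun ψ => (h₀.cont ψ).comp continuous_neg) h1
    exact (h2.const_smul Complex.I).neg
  choose w hw0 hw using fun ψ => exists_linear_ode (norm_nonneg B) hK hKc ψ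
  have huniq : ∀ ψ (v : ℝ → E), v 0 = ψ → (∀ t, HasDerivAt v (K t (v t)) t) → v = w ψ :=
    fun ψ v h0 hv => linear_ode_unique hK hv (hw ψ) (h0.trans (hw0 ψ).symm)
  have hadd : ∀ ψ φ t, w (ψ + φ) t = w ψ t + w φ t := by
    intro ψ φ t
    refine (congrFun (huniq (ψ + φ) (fun t => w ψ t + w φ t) (by simp [hw0]) fun t => ?_) t).symm
    rw [map_add]; exact (hw ψ t).add (hw φ t)
  have hsmul : ∀ (c : ℂ) ψ t, w (c • ψ) t = c • w ψ t := by
    intro c ψ t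
    refine (congrFun (huniq (c • ψ) (fun t => c • w ψ t) (by simp [hw0]) fun t => ?_) t).symm
    rw [map_smul]; exact (hw ψ t).const_smul c
  have hnorm : ∀ ψ t, ‖w ψ t‖ = ‖ψ‖ := by
    intro ψ t
    have hd : ∀ t, HasDerivAt (fun t => inner ℂ (w ψ t) (w ψ t)) 0 t := by
      intro t
      have := (hw ψ t).inner ℂ (hw ψ t)
      refine this.congr_deriv ?_
      have h1 : ∀ s (x y : E), inner ℂ (U₀ (-s) x) y = inner ℂ x (U₀ s y) := fun s x y => by
        rw [← hin s, hinv']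
      have h2 : ∀ s (x y : E), inner ℂ x (U₀ (-s) y) = inner ℂ (U₀ s x) y := fun s x y => by
        rw [← hin s, hinv']
      simp only [K_apply, inner_neg_left, inner_neg_right, inner_smul_left, inner_smul_right, h1, h2,
        hB]
      simp
    have := is_const_of_deriv_eq_zero (fun t => (hd t).differentiableAt) (fun t => (hd t).deriv) t 0
    simp only [hw0] at this
    rw [inner_self_eq_norm_sq_to_K, inner_self_eq_norm_sq_to_K] at this
    norm_cast at this
    exact (pow_left_inj₀ (norm_nonneg _) (norm_nonneg _) two_ne_zero).1 this
  let W : ℝ → E →L[ℂ] E := fun t =>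
    LinearMap.mkContinuous ⟨⟨fun ψ => w ψ t, fun ψ φ => hadd ψ φ t⟩, fun c ψ => hsmul c ψ t⟩ 1
      (fun ψ => by simp [hnorm])
  have W_apply : ∀ t ψ, W t ψ = w ψ t := fun t ψ => rfl
  have hWc : ∀ ψ, Continuous (w ψ) := fun ψ => continuous_iff_continuousAt.2 fun t =>
    (hw ψ t).continuousAt
  refine ⟨fun t => (U₀ t).comp (W t), ?_, ?_, ?_, ?_, ?_⟩
  · ext ψ; simp [h₀.zero, W_apply, hw0]
  · intro s t
    ext ψ
    simp only [ContinuousLinearMap.comp_apply, mul_apply_eq_comp, W_apply]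
    have := huniq (U₀ t (w ψ t)) (fun s => U₀ t (w ψ (s + t))) (by simp) (fun s => by
      have h1 := ((U₀ t).restrictScalars ℝ).hasFDerivAt.comp_hasDerivAt s
        ((hw ψ (s + t)).comp_add_const s t)
      refine h1.congr_deriv ?_
      simp only [K_apply, ContinuousLinearMap.coe_restrictScalars', map_neg, map_smul]
      rw [add_comm s t, h₀.add, mul_apply_eq_comp, ← mul_apply_eq_comp (U₀ t),
        ← h₀.add, show t + -(t + s) = -s by ring, ← mul_apply_eq_comp (U₀ t),
        ← mul_apply_eq_comp (U₀ s), ← h₀.add, ← h₀.add, add_comm t s])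
    rw [← this, h₀.add, mul_apply_eq_comp]
  · intro t ψ
    simp [W_apply, h₀.norm_map, hnorm]
  · intro ψ
    exact continuous_apply_of_norm_map h₀.norm_map h₀.cont (hWc ψ)
  · intro ψ φ
    rw [hA, h₀.generator]
    simp only [ContinuousLinearMap.comp_apply, W_apply]
    have hdiff : HasDerivAt (fun t => U₀ t (w ψ t - ψ)) (-(Complex.I • B ψ)) 0 := by
      rw [hasDerivAt_iff_tendsto_slope]
      have h1 := hasDerivAt_iff_tendsto_slope.1 (hw ψ 0)
      rw [K_apply, hw0, neg_zero, h₀.zero] at h1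
      simp only [one_apply_eq_self] at h1
      have h2 : Tendsto (fun t => U₀ t (slope (w ψ) 0 t - -(Complex.I • B ψ)) +
          U₀ t (-(Complex.I • B ψ))) (𝓝[≠] 0) (𝓝 (0 + -(Complex.I • B ψ))) := by
        refine Tendsto.add ?_ ?_
        · rw [tendsto_zero_iff_norm_tendsto_zero]
          simp only [h₀.norm_map]
          have := h1.sub_const (-(Complex.I • B ψ))
          rw [sub_self] at this
          simpa using this.norm
        · have := ((h₀.cont (-(Complex.I • B ψ))).tendsto 0).mono_left
            (nhdsWithin_le_nhds (s := {0}ᶜ))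
          simpa [h₀.zero] using this
      rw [zero_add] at h2
      refine h2.congr fun t => ?_
      rw [← map_add, sub_add_cancel, slope_def_module, slope_def_module, hw0]
      simp
    have hsplit : (fun t => U₀ t (w ψ t)) = fun t => U₀ t ψ + U₀ t (w ψ t - ψ) := by
      funext t; rw [← map_add]; simp
    rw [hsplit]
    constructor
    · intro h
      refine (h.add hdiff).congr_deriv ?_
      rw [smul_sub]; abel
    · intro h
      have := h.sub hdiff
      refine (this.congr_deriv (g' := -(Complex.I • (φ - B ψ))) ?_).congr_of_eventuallyEq ?_
      · rw [smul_sub]; abel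
      · exact Eventually.of_forall fun t => by simp

/-- The unitary group of a densely defined operator is unique. -/
theorem IsUnitaryGroup.unique {A : E →ₗ.[ℂ] E} (hd : Dense (A.domain : Set E))
    {U W : ℝ → E →L[ℂ] E} (hU : IsUnitaryGroup A U) (hW : IsUnitaryGroup A W) : U = W := by
  have hder : ∀ {U : ℝ → E →L[ℂ] E}, IsUnitaryGroup A U → ∀ {ψ φ : E}, (ψ, φ) ∈ A.graph → ∀ t,
      (U t ψ, U t φ) ∈ A.graph ∧ HasDerivAt (fun t => U t ψ) (-(Complex.I • U t φ)) t := by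
    intro U hU ψ φ h t
    have h0 := (hU.generator _ _).1 h
    have h1 := ((U t).restrictScalars ℝ).hasFDerivAt.comp_hasDerivAt 0 h0
    simp only [ContinuousLinearMap.coe_restrictScalars', map_neg, map_smul] at h1
    constructor
    · rw [hU.generator]
      refine h1.congr_of_eventuallyEq (Eventually.of_forall fun s => ?_)
      change U s (U t ψ) = U t (U s ψ)
      rw [← mul_apply_eq_comp, ← mul_apply_eq_comp, ← hU.add, ← hU.add, add_comm]
    · have h2 : HasDerivAt (fun s => U t (U s ψ)) (-(Complex.I • U t φ)) (t - t) := by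
        rw [sub_self]; exact h1
      refine (h2.comp_sub_const t t).congr_of_eventuallyEq (Eventually.of_forall fun s => ?_)
      change U s ψ = U t (U (s - t) ψ)
      rw [← mul_apply_eq_comp, ← hU.add, add_sub_cancel]
  have hre : ∀ {ψ φ : E}, (ψ, φ) ∈ A.graph →
      inner ℂ ψ (-(Complex.I • φ)) + inner ℂ (-(Complex.I • φ)) ψ = 0 := by
    intro ψ φ h
    have h0 := (hU.generator _ _).1 h
    have h1 := h0.inner ℂ h0
    have h2 : (fun t => inner ℂ (U t ψ) (U t ψ)) = fun _ => inner ℂ ψ ψ := by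
      funext t
      exact (⟨(U t).toLinearMap, hU.norm_map t⟩ : E →ₗᵢ[ℂ] E).inner_map_map ψ ψ
    rw [h2] at h1
    have := h1.unique (hasDerivAt_const _ _)
    simpa [hU.zero] using this
  have key : ∀ ψ ∈ A.domain, ∀ t, U t ψ = W t ψ := by
    intro ψ hψ t
    have hg : (ψ, A ⟨ψ, hψ⟩) ∈ A.graph := A.mem_graph ⟨ψ, hψ⟩
    have hdd : ∀ t, HasDerivAt
        (fun t => inner ℂ (U t ψ - W t ψ) (U t ψ - W t ψ)) 0 t := by
      intro t
      have h1 := (hder hU hg t).2.sub (hder hW hg t).2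
      have h2 := h1.inner ℂ h1
      refine h2.congr_deriv ?_
      have h3 := hre (A.graph.sub_mem (hder hU hg t).1 (hder hW hg t).1)
      have h4 : -(Complex.I • U t (A ⟨ψ, hψ⟩)) - -(Complex.I • W t (A ⟨ψ, hψ⟩)) =
          -(Complex.I • (U t (A ⟨ψ, hψ⟩) - W t (A ⟨ψ, hψ⟩))) := by rw [smul_sub]; abel
      rw [h4]
      exact h3
    have := is_const_of_deriv_eq_zero (fun t => (hdd t).differentiableAt)
      (fun t => (hdd t).deriv) t 0
    simp only [hU.zero, hW.zero, sub_self, inner_zero_left] at this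
    exact sub_eq_zero.1 (inner_self_eq_zero.1 this)
  funext t
  ext ψ
  exact congrFun ((U t).continuous.ext_on hd (W t).continuous fun x hx => key x hx t) ψ

end Abstract

/-! ### Multiplication by a unimodular phase -/

theorem tendsto_L2_of_dominated {ι : Type*} {l : Filter ι} [l.IsCountablyGenerated]
    {F : ι → L2R} {Φ : ι → ℝ → ℂ} (hF : ∀ n, F n =ᵐ[volume] Φ n) {f : L2R} {G : ℝ → ℝ}
    (hG : MemLp G 2 volume) (hb : ∀ n, ∀ᵐ x, ‖Φ n x - f x‖ ≤ G x)
    (hl : ∀ᵐ x, Tendsto (fun n => Φ n x) l (𝓝 (f x))) : Tendsto F l (𝓝 f) := by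
  rw [Lp.tendsto_Lp_iff_tendsto_eLpNorm']
  have h1 : ∀ n, eLpNorm (⇑(F n) - ⇑f) 2 volume
      = (∫⁻ x, ‖Φ n x - f x‖ₑ ^ (2 : ℝ)) ^ (1 / 2 : ℝ) := by
    intro n
    rw [eLpNorm_congr_ae ((hF n).sub (ae_eq_refl f)),
      eLpNorm_eq_lintegral_rpow_enorm_toReal two_ne_zero ENNReal.ofNat_ne_top]
    simp
  simp only [h1]
  have h2 : Tendsto (fun n => ∫⁻ x, ‖Φ n x - f x‖ₑ ^ (2 : ℝ)) l (𝓝 (∫⁻ _ : ℝ, 0)) := by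
    refine tendsto_lintegral_filter_of_dominated_convergence' (fun x => ‖G x‖ₑ ^ (2 : ℝ))
      (Eventually.of_forall fun n => ?_) (Eventually.of_forall fun n => ?_) ?_ ?_
    · have : AEStronglyMeasurable (Φ n) volume := (Lp.aestronglyMeasurable (F n)).congr (hF n)
      exact (this.sub (Lp.aestronglyMeasurable f)).enorm.pow_const _
    · filter_upwards [hb n] with x hx
      gcongr
      rw [enorm_le_iff_norm_le]
      exact hx.trans (le_abs_self _)
    · have := hG.2
      rw [eLpNorm_lt_top_iff_lintegral_rpow_enorm_lt_top two_ne_zero ENNReal.ofNat_ne_top] at this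
      simpa using this.ne
    · filter_upwards [hl] with x hx
      have h3 : Tendsto (fun n => ‖Φ n x - f x‖ₑ) l (𝓝 0) := by
        have := (hx.sub_const (f x)).enorm
        simpa using this
      have := h3.ennrpow_const (2 : ℝ)
      simpa using this
  rw [lintegral_zero] at h2
  have := h2.ennrpow_const (1 / 2 : ℝ)
  simpa using this

noncomputable def phase (q : ℝ → ℝ) (t : ℝ) (ξ : ℝ) : ℂ := Complex.exp (-(Complex.I * (t * q ξ : ℝ)))

theorem norm_phase (q : ℝ → ℝ) (t ξ : ℝ) : ‖phase q t ξ‖ = 1 := by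
  rw [phase, mul_comm, ← neg_mul, ← Complex.ofReal_neg, Complex.norm_exp_ofReal_mul_I]

theorem exists_phase_group {q : ℝ → ℝ} (hq : Continuous q) :
    ∃ M : ℝ → L2R →L[ℂ] L2R, ∀ t f, M t f =ᵐ[volume] fun ξ => phase q t ξ * f ξ := by
  have hm : ∀ t, MemLp (phase q t) ∞ volume := fun t =>
    memLp_top_of_bound (Continuous.aestronglyMeasurable (by unfold phase; fun_prop)) 1
      (ae_of_all _ fun ξ => (norm_phase q t ξ).le)
  have hae : ∀ t (f : L2R), ((hm t).toLp • f : L2R) =ᵐ[volume] fun ξ => phase q t ξ * f ξ := by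
    intro t f
    filter_upwards [Lp.coeFn_lpSMul (r := 2) (hm t).toLp f, (hm t).coeFn_toLp] with x h1 h2
    rw [h1, Pi.smul_apply', h2, smul_eq_mul]
  refine ⟨fun t => LinearMap.mkContinuous ⟨⟨fun f => (hm t).toLp • f, fun f g => ?_⟩,
    fun c f => ?_⟩ ‖(hm t).toLp‖ fun f => ?_, hae⟩
  · exact Lp.add_smul (hm t).toLp f g
  · exact (Lp.smul_comm c (hm t).toLp f).symm
  · exact Lp.norm_smul_le (hm t).toLp f

theorem phase_hasDerivAt (q : ℝ → ℝ) (ξ : ℝ) :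
    HasDerivAt (fun t => phase q t ξ) (-(Complex.I * q ξ)) 0 := by
  have h1 : HasDerivAt (fun t : ℝ => -(Complex.I * (t * q ξ : ℝ))) (-(Complex.I * q ξ)) 0 := by
    have : HasDerivAt (fun t : ℝ => ((t * q ξ : ℝ) : ℂ)) ((1 * q ξ : ℝ) : ℂ) 0 :=
      ((hasDerivAt_id (0 : ℝ)).mul_const (q ξ)).ofReal_comp
    rw [one_mul] at this
    exact (this.const_mul Complex.I).neg
  have := h1.cexp
  simpa [phase] using this

theorem norm_phase_sub_one_le (q : ℝ → ℝ) (t ξ : ℝ) : ‖phase q t ξ - 1‖ ≤ |t| * |q ξ| := by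
  have := Real.norm_exp_I_mul_ofReal_sub_one_le (x := -(t * q ξ))
  rw [phase, ← mul_neg, ← Complex.ofReal_neg]
  refine this.trans ?_
  rw [norm_neg, norm_mul, Real.norm_eq_abs, Real.norm_eq_abs]

theorem phase_group_props {q : ℝ → ℝ} {M : ℝ → L2R →L[ℂ] L2R}
    (hM : ∀ t f, M t f =ᵐ[volume] fun ξ => phase q t ξ * f ξ) :
    M 0 = 1 ∧ (∀ s t, M (s + t) = M s * M t) ∧ (∀ t f, ‖M t f‖ = ‖f‖) ∧
    (∀ f, Continuous fun t => M t f) ∧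
    (∀ f g : L2R, (g =ᵐ[volume] fun ξ => q ξ * f ξ) ↔
      HasDerivAt (fun t => M t f) (-(Complex.I • g)) 0) := by
  have h0 : M 0 = 1 := by
    ext f : 1
    refine Lp.ext ?_
    filter_upwards [hM 0 f] with x h1
    rw [h1]; simp [phase]
  have hadd : ∀ s t, M (s + t) = M s * M t := by
    intro s t
    ext f : 1
    refine Lp.ext ?_
    rw [mul_apply_eq_comp]
    filter_upwards [hM (s + t) f, hM s (M t f), hM t f] with x h1 h2 h3
    rw [h1, h2, h3, ← mul_assoc]
    congr 1
    rw [phase, phase, phase, ← Complex.exp_add]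
    congr 1
    push_cast
    ring
  have hnorm : ∀ t f, ‖M t f‖ = ‖f‖ := by
    intro t f
    rw [Lp.norm_def, Lp.norm_def]
    congr 1
    refine eLpNorm_congr_norm_ae ?_
    filter_upwards [hM t f] with x h1
    rw [h1, norm_mul, norm_phase, one_mul]
  refine ⟨h0, hadd, hnorm, ?_, ?_⟩
  · intro f
    rw [continuous_iff_continuousAt]
    intro t
    have hb : MemLp (fun x => 2 * ‖f x‖) 2 volume := (Lp.memLp f).norm.const_mul 2
    refine tendsto_L2_of_dominated (Φ := fun s ξ => phase q (s - t) ξ * M t f ξ) (G := fun x => 2 * ‖f x‖)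
      (fun s => ?_) hb (fun s => ?_) ?_
    · have : M s f = M (s - t) (M t f) := by rw [← mul_apply_eq_comp, ← hadd, sub_add_cancel]
      rw [this]
      exact hM _ _
    · filter_upwards [hM t f] with x h1
      calc ‖phase q (s - t) x * M t f x - M t f x‖ ≤ ‖phase q (s - t) x * M t f x‖ + ‖M t f x‖ :=
            norm_sub_le _ _
        _ = 2 * ‖f x‖ := by
            rw [norm_mul, norm_phase, h1, norm_mul, norm_phase]; ring
    · refine ae_of_all _ fun x => ?_
      have h1 : Continuous fun s => phase q (s - t) x * M t f x := by unfold phase; fun_prop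
      have := h1.tendsto t
      simpa [phase] using this
  · intro f g
    have hsl : ∀ t, slope (fun t => M t f) 0 t =ᵐ[volume]
        fun ξ => slope (fun t => phase q t ξ) 0 t * f ξ := by
      intro t
      rw [slope_def_module, h0, one_apply_eq_self]
      filter_upwards [Lp.coeFn_smul ((t - 0)⁻¹) (M t f - f), Lp.coeFn_sub (M t f) f, hM t f]
        with x h1 h2 h3
      rw [h1, Pi.smul_apply, h2, Pi.sub_apply, h3, slope_def_module]
      simp [phase, sub_mul, mul_assoc]
    rw [hasDerivAt_iff_tendsto_slope]
    constructor
    · intro hg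
      have hig : (-(Complex.I • g) : L2R) =ᵐ[volume] fun ξ => -(Complex.I * q ξ) * f ξ := by
        filter_upwards [Lp.coeFn_neg (Complex.I • g), Lp.coeFn_smul Complex.I g, hg] with x h1 h2 h3
        rw [h1, Pi.neg_apply, h2, Pi.smul_apply, h3, smul_eq_mul]; ring
      have hb : MemLp (fun x => 2 * ‖g x‖) 2 volume := (Lp.memLp g).norm.const_mul 2
      refine tendsto_L2_of_dominated hsl hb (fun t => ?_) ?_
      · filter_upwards [hig, hg] with x h1 h2
        rw [h1, h2]
        have h3 : ‖slope (fun t => phase q t x) 0 t‖ ≤ |q x| := by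
          rw [slope_def_module, norm_smul, sub_zero]
          have := norm_phase_sub_one_le q t x
          rcases eq_or_ne t 0 with rfl | ht
          · simp
          · have h4 : phase q 0 x = 1 := by simp [phase]
            rw [h4, norm_inv, Real.norm_eq_abs, inv_mul_le_iff₀ (abs_pos.2 ht)]
            exact this
        calc _ ≤ ‖slope (fun t => phase q t x) 0 t * f x‖ + ‖-(Complex.I * q x) * f x‖ :=
              norm_sub_le _ _
          _ ≤ |q x| * ‖f x‖ + |q x| * ‖f x‖ := by
              rw [norm_mul, norm_mul, norm_neg, norm_mul, Complex.norm_I, one_mul,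
                Complex.norm_real, Real.norm_eq_abs]
              gcongr
          _ = _ := by rw [norm_mul, Complex.norm_real, Real.norm_eq_abs]; ring
      · filter_upwards [hig] with x h1
        rw [h1]
        exact (hasDerivAt_iff_tendsto_slope.1 (phase_hasDerivAt q x)).mul_const _
    · intro h
      obtain ⟨ns, hns, hae⟩ := (tendstoInMeasure_of_tendsto_Lp h).exists_seq_tendsto_ae'
      have hall := ae_all_iff.2 fun n => hsl (ns n)
      filter_upwards [hae, hall, Lp.coeFn_neg (Complex.I • g), Lp.coeFn_smul Complex.I g]
        with x h1 h2 h3 h4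
      have h5 := ((hasDerivAt_iff_tendsto_slope.1 (phase_hasDerivAt q x)).mul_const (f x)).comp hns
      have h6 := tendsto_nhds_unique (h1.congr h2) h5
      rw [h3, Pi.neg_apply, h4, Pi.smul_apply, smul_eq_mul] at h6
      have h7 : Complex.I * g x = Complex.I * (q x * f x) := by linear_combination -h6
      exact mul_left_cancel₀ Complex.I_ne_zero h7

/-! ### Weak derivatives -/

/-- `g ∈ L²(ℝ)` is the weak (distributional) derivative of `f ∈ L²(ℝ)`, i.e.
`∫ φ g = -∫ φ' f` for all Schwartz functions `φ` (see `hasWeakDeriv_iff`). -/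
def HasWeakDeriv (f g : L2R) : Prop :=
  ∂_{(1 : ℝ)} (f : 𝓢'(ℝ, ℂ)) = (g : 𝓢'(ℝ, ℂ))

theorem hasWeakDeriv_iff {f g : L2R} : HasWeakDeriv f g ↔
    ∀ φ : 𝓢(ℝ, ℂ), ∫ x, φ x * g x = -∫ x, deriv φ x * f x := by
  have h : ∀ φ : 𝓢(ℝ, ℂ), (∂_{(1 : ℝ)} (f : 𝓢'(ℝ, ℂ))) φ = -∫ x, deriv φ x * f x := by
    intro φ
    rw [TemperedDistribution.lineDerivOp_apply_apply, Lp.toTemperedDistribution_apply,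
      ← integral_neg]
    refine integral_congr_ae (ae_of_all _ fun x => ?_)
    have h1 : lineDeriv ℝ (⇑φ) x 1 = deriv (⇑φ) x := by
      simp [lineDeriv, deriv_comp_const_add]
    simp [SchwartzMap.lineDerivOp_apply, h1]
  constructor
  · intro hfg φ
    rw [← h, hfg, Lp.toTemperedDistribution_apply]
    rfl
  · intro hfg
    ext φ
    rw [h, ← hfg, Lp.toTemperedDistribution_apply]
    rfl

theorem toTemperedDistribution_inj {f g : L2R} (h : (f : 𝓢'(ℝ, ℂ)) = (g : 𝓢'(ℝ, ℂ))) : f = g := by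
  have h1 := LinearMap.ker_eq_bot.1
    (Lp.ker_toTemperedDistributionCLM_eq_bot (E := ℝ) (F := ℂ) (μ := volume) (p := 2))
  exact h1 h

theorem HasWeakDeriv.unique {f g h : L2R} (hg : HasWeakDeriv f g) (hh : HasWeakDeriv f h) : g = h :=
  toTemperedDistribution_inj (hg.symm.trans hh)

theorem coe_add (f g : L2R) : ((f + g : L2R) : 𝓢'(ℝ, ℂ)) = (f : 𝓢'(ℝ, ℂ)) + (g : 𝓢'(ℝ, ℂ)) :=
  map_add (Lp.toTemperedDistributionCLM ℂ (volume : Measure ℝ) 2) f g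

theorem coe_smul (c : ℂ) (f : L2R) : ((c • f : L2R) : 𝓢'(ℝ, ℂ)) = c • (f : 𝓢'(ℝ, ℂ)) :=
  map_smul (Lp.toTemperedDistributionCLM ℂ (volume : Measure ℝ) 2) c f

theorem HasWeakDeriv.add {f g f' g' : L2R} (hf : HasWeakDeriv f f') (hg : HasWeakDeriv g g') :
    HasWeakDeriv (f + g) (f' + g') := by
  unfold HasWeakDeriv at *
  rw [coe_add, coe_add, ← hf, ← hg, LineDeriv.lineDerivOp_add]

theorem HasWeakDeriv.smul {f f' : L2R} (c : ℂ) (hf : HasWeakDeriv f f') :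
    HasWeakDeriv (c • f) (c • f') := by
  unfold HasWeakDeriv at *
  rw [coe_smul, coe_smul, ← hf, LineDeriv.lineDerivOp_smul]

theorem hasWeakDeriv_iff_fourier {f g : L2R} : HasWeakDeriv f g ↔
    (𝓕 g : L2R) =ᵐ[volume] fun ξ => (2 * Real.pi * Complex.I * ξ : ℂ) * (𝓕 f : L2R) ξ := by
  have h0 : HasWeakDeriv f g ↔ 𝓕 (∂_{(1 : ℝ)} (f : 𝓢'(ℝ, ℂ))) = 𝓕 (g : 𝓢'(ℝ, ℂ)) := by
    constructor
    · intro h; rw [h]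
    · intro h
      have := congrArg 𝓕⁻ h
      rwa [FourierTransform.fourierInv_fourier_eq, FourierTransform.fourierInv_fourier_eq] at this
  have hq : (fun x : ℝ => ((inner ℝ x (1 : ℝ) : ℝ) : ℂ)).HasTemperateGrowth := by fun_prop
  rw [h0, TemperedDistribution.fourier_lineDerivOp_eq, Lp.fourier_toTemperedDistribution_eq,
    Lp.fourier_toTemperedDistribution_eq]
  have h1 : ∀ u : 𝓢(ℝ, ℂ), ((2 * Real.pi * Complex.I) • TemperedDistribution.smulLeftCLM ℂ
      (fun x : ℝ => ((inner ℝ x (1 : ℝ) : ℝ) : ℂ)) ((𝓕 f : L2R) : 𝓢'(ℝ, ℂ))) u =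
      ∫ ξ, u ξ • ((2 * Real.pi * Complex.I * ξ : ℂ) * (𝓕 f : L2R) ξ) := by
    intro u
    change (2 * Real.pi * Complex.I) • (TemperedDistribution.smulLeftCLM ℂ
      (fun x : ℝ => ((inner ℝ x (1 : ℝ) : ℝ) : ℂ)) ((𝓕 f : L2R) : 𝓢'(ℝ, ℂ)) u) = _
    rw [TemperedDistribution.smulLeftCLM_apply_apply, Lp.toTemperedDistribution_apply,
      ← integral_smul]
    refine integral_congr_ae (ae_of_all _ fun ξ => ?_)
    simp only [SchwartzMap.smulLeftCLM_apply_apply hq, smul_eq_mul]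
    simp
    ring
  constructor
  · intro h
    refine (ae_eq_of_integral_contDiff_smul_eq ?_ ?_ ?_)
    · exact (Lp.memLp (𝓕 g : L2R)).locallyIntegrable (by norm_num)
    · have := ((Lp.memLp (𝓕 f : L2R)).locallyIntegrable (by norm_num))
      have hc : Continuous fun ξ : ℝ => (2 * Real.pi * Complex.I * ξ : ℂ) := by fun_prop
      exact this.continuous_smul hc
    · intro u hu hs
      have hs1 : HasCompactSupport (Complex.ofRealCLM ∘ u) := hs.comp_left rfl
      have hs2 : ContDiff ℝ (⊤ : ℕ∞) (Complex.ofRealCLM ∘ u) := by fun_prop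
      have h2 := congrArg (fun T : 𝓢'(ℝ, ℂ) => T (hs1.toSchwartzMap hs2)) h
      simp only [h1, Lp.toTemperedDistribution_apply] at h2
      exact h2.symm
  · intro h
    ext u
    rw [h1, Lp.toTemperedDistribution_apply]
    refine integral_congr_ae ?_
    filter_upwards [h] with ξ hξ
    rw [hξ]

/-! ### Weak derivatives and the Sobolev space `H²(ℝ)` -/

theorem hasWeakDeriv_zero : HasWeakDeriv 0 0 := by
  rw [hasWeakDeriv_iff_fourier]
  have h : (𝓕 (0 : L2R) : L2R) = 0 := map_zero (Lp.fourierTransformₗᵢ ℝ ℂ)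
  rw [h]
  filter_upwards [Lp.coeFn_zero ℂ 2 (volume : Measure ℝ)] with ξ hξ
  rw [hξ]
  simp

open Classical in
/-- The weak derivative of `f`, with the value `0` if `f` has no weak derivative in `L²(ℝ)`. -/
noncomputable def weakDeriv (f : L2R) : L2R :=
  if h : ∃ g, HasWeakDeriv f g then h.choose else 0

theorem HasWeakDeriv.weakDeriv_eq {f g : L2R} (h : HasWeakDeriv f g) : weakDeriv f = g := by
  have h' : ∃ g, HasWeakDeriv f g := ⟨g, h⟩
  rw [weakDeriv, dif_pos h']
  exact h'.choose_spec.unique h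

/-- The Sobolev space `H²(ℝ)`: the `ψ ∈ L²(ℝ)` with two weak derivatives in `L²(ℝ)`. -/
def sobolevH2 : Submodule ℂ L2R where
  carrier := {ψ | ∃ ψ₁ ψ₂ : L2R, HasWeakDeriv ψ ψ₁ ∧ HasWeakDeriv ψ₁ ψ₂}
  add_mem' := by
    rintro ψ φ ⟨ψ₁, ψ₂, h₁, h₂⟩ ⟨φ₁, φ₂, k₁, k₂⟩
    exact ⟨_, _, h₁.add k₁, h₂.add k₂⟩
  zero_mem' := ⟨0, 0, hasWeakDeriv_zero, hasWeakDeriv_zero⟩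
  smul_mem' := by
    rintro c ψ ⟨ψ₁, ψ₂, h₁, h₂⟩
    exact ⟨_, _, h₁.smul c, h₂.smul c⟩

/-- The norm `‖ψ‖_{H²} = (‖ψ‖² + ‖ψ'‖² + ‖ψ''‖²)^{1/2}` for `ψ ∈ H²(ℝ)`. -/
noncomputable def sobolevH2Norm (ψ : L2R) : ℝ :=
  Real.sqrt (‖ψ‖ ^ 2 + ‖weakDeriv ψ‖ ^ 2 + ‖weakDeriv (weakDeriv ψ)‖ ^ 2)

/-! ### The Schrödinger operator and the position operator -/

theorem lpSMul_smul (V : Lp ℝ ∞ (volume : Measure ℝ)) (c : ℂ) (ψ : L2R) :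
    (V • (c • ψ) : L2R) = c • (V • ψ : L2R) := by
  refine Lp.ext ?_
  filter_upwards [Lp.coeFn_lpSMul (r := 2) V (c • ψ), Lp.coeFn_smul c (V • ψ : L2R),
    Lp.coeFn_lpSMul (r := 2) V ψ, Lp.coeFn_smul c ψ] with x h1 h2 h3 h4
  rw [h1, h2, Pi.smul_apply', Pi.smul_apply, h3, h4, Pi.smul_apply', Pi.smul_apply, smul_comm]

/-- The Schrödinger operator `H = -d²/dx² + V` in `L²(ℝ)` with domain `H²(ℝ)`, for a real-valued
potential `V ∈ L^∞(ℝ)`. -/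
noncomputable def schrodingerOp (V : Lp ℝ ∞ (volume : Measure ℝ)) : L2R →ₗ.[ℂ] L2R where
  domain := sobolevH2
  toFun :=
    { toFun := fun ψ => -weakDeriv (weakDeriv (ψ : L2R)) + V • (ψ : L2R)
      map_add' := by
        rintro ⟨ψ, ψ₁, ψ₂, h₁, h₂⟩ ⟨φ, φ₁, φ₂, k₁, k₂⟩
        simp only [Submodule.coe_add, h₁.weakDeriv_eq, h₂.weakDeriv_eq, k₁.weakDeriv_eq,
          k₂.weakDeriv_eq, (h₁.add k₁).weakDeriv_eq, (h₂.add k₂).weakDeriv_eq]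
        rw [Lp.add_smul]
        abel
      map_smul' := by
        rintro c ⟨ψ, ψ₁, ψ₂, h₁, h₂⟩
        simp only [Submodule.coe_smul, h₁.weakDeriv_eq, h₂.weakDeriv_eq, (h₁.smul c).weakDeriv_eq,
          (h₂.smul c).weakDeriv_eq, RingHom.id_apply]
        rw [lpSMul_smul, smul_add, smul_neg] }

/-- The square `X²` of the position operator: multiplication by `x²` in `L²(ℝ)`, with domain
`{ψ ∈ L²(ℝ) : x² ψ ∈ L²(ℝ)}`. -/
noncomputable def positionSq : L2R →ₗ.[ℂ] L2R where
  domain :=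
    { carrier := {ψ | MemLp (fun x : ℝ => (x : ℂ) ^ 2 * ψ x) 2 volume}
      add_mem' := by
        intro ψ φ hψ hφ
        refine (hψ.add hφ).ae_eq ?_
        filter_upwards [Lp.coeFn_add ψ φ] with x hx
        rw [hx, Pi.add_apply, Pi.add_apply, mul_add]
      zero_mem' := by
        refine (MemLp.zero (ε := ℂ)).ae_eq ?_
        filter_upwards [Lp.coeFn_zero ℂ 2 (volume : Measure ℝ)] with x hx
        rw [hx]; simp
      smul_mem' := by
        intro c ψ hψ
        refine (hψ.const_smul c).ae_eq ?_
        filter_upwards [Lp.coeFn_smul c ψ] with x hx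
        rw [hx, Pi.smul_apply, Pi.smul_apply, smul_eq_mul, smul_eq_mul]; ring }
  toFun :=
    { toFun := fun ψ => MemLp.toLp (fun x : ℝ => (x : ℂ) ^ 2 * (ψ : L2R) x) ψ.2
      map_add' := by
        rintro ⟨ψ, hψ⟩ ⟨φ, hφ⟩
        rw [← MemLp.toLp_add]
        refine MemLp.toLp_congr _ _ ?_
        filter_upwards [Lp.coeFn_add ψ φ] with x hx
        simp only [Submodule.coe_add, Pi.add_apply]
        rw [hx, Pi.add_apply, mul_add]
      map_smul' := by
        rintro c ⟨ψ, hψ⟩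
        rw [RingHom.id_apply, ← MemLp.toLp_const_smul]
        refine MemLp.toLp_congr _ _ ?_
        filter_upwards [Lp.coeFn_smul c ψ] with x hx
        simp only [Submodule.coe_smul, Pi.smul_apply]
        rw [hx, Pi.smul_apply, smul_eq_mul, smul_eq_mul]; ring }

/-! ### The unitary group generated by the Schrödinger operator -/

theorem mem_graph_schrodingerOp {V : Lp ℝ ∞ (volume : Measure ℝ)} {ψ φ : L2R} :
    (ψ, φ) ∈ (schrodingerOp V).graph ↔
      ∃ ψ₁ ψ₂ : L2R, HasWeakDeriv ψ ψ₁ ∧ HasWeakDeriv ψ₁ ψ₂ ∧ φ = -ψ₂ + V • ψ := by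
  rw [LinearPMap.mem_graph_iff]
  constructor
  · rintro ⟨⟨_, ψ₁, ψ₂, h₁, h₂⟩, rfl, h⟩
    refine ⟨ψ₁, ψ₂, h₁, h₂, h.symm.trans ?_⟩
    simp [schrodingerOp, h₁.weakDeriv_eq, h₂.weakDeriv_eq]
  · rintro ⟨ψ₁, ψ₂, h₁, h₂, rfl⟩
    refine ⟨⟨ψ, ψ₁, ψ₂, h₁, h₂⟩, rfl, ?_⟩
    simp [schrodingerOp, h₁.weakDeriv_eq, h₂.weakDeriv_eq]

theorem mem_graph_free {ψ φ : L2R} : (ψ, φ) ∈ (schrodingerOp 0).graph ↔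
    (𝓕 φ : L2R) =ᵐ[volume] fun ξ => (((2 * Real.pi * ξ) ^ 2 : ℝ) : ℂ) * (𝓕 ψ : L2R) ξ := by
  rw [mem_graph_schrodingerOp]
  constructor
  · rintro ⟨ψ₁, ψ₂, h₁, h₂, h⟩
    have h3 : (𝓕 φ : L2R) = -𝓕 ψ₂ := by
      rw [h, Lp.zero_smul, add_zero]
      exact map_neg (Lp.fourierTransformₗᵢ ℝ ℂ) ψ₂
    rw [h3]
    filter_upwards [hasWeakDeriv_iff_fourier.1 h₁, hasWeakDeriv_iff_fourier.1 h₂,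
      Lp.coeFn_neg (𝓕 ψ₂ : L2R)] with ξ k₁ k₂ k₃
    rw [k₃, Pi.neg_apply, k₂, k₁]
    push_cast
    linear_combination (-(4 * Real.pi ^ 2 * ξ ^ 2 * (𝓕 ψ : L2R) ξ)) * Complex.I_sq
  · intro h
    have hmem : MemLp (fun ξ : ℝ => (2 * Real.pi * Complex.I * ξ : ℂ) * (𝓕 ψ : L2R) ξ) 2 volume := by
      have hb : MemLp (fun ξ => ‖(𝓕 ψ : L2R) ξ‖ + ‖(𝓕 φ : L2R) ξ‖) 2 volume :=
        (Lp.memLp _).norm.add (Lp.memLp _).norm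
      refine hb.mono' ?_ ?_
      · exact (Continuous.aestronglyMeasurable (by fun_prop)).mul (Lp.aestronglyMeasurable _)
      · filter_upwards [h] with ξ hξ
        rw [hξ, norm_mul _ ((𝓕 ψ : L2R) ξ), norm_mul _ ((𝓕 ψ : L2R) ξ), ← one_add_mul]
        gcongr
        have : ‖(2 * Real.pi * Complex.I * ξ : ℂ)‖ = |2 * Real.pi * ξ| := by
          simp [abs_mul]
        rw [this, Complex.norm_real, Real.norm_eq_abs, abs_pow]
        nlinarith [sq_nonneg (|2 * Real.pi * ξ| - 1), abs_nonneg (2 * Real.pi * ξ)]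
    have hF : (𝓕 (𝓕⁻ (hmem.toLp) : L2R) : L2R) = hmem.toLp := FourierTransform.fourier_fourierInv_eq _
    refine ⟨𝓕⁻ hmem.toLp, -φ, ?_, ?_, ?_⟩
    · rw [hasWeakDeriv_iff_fourier, hF]
      exact hmem.coeFn_toLp
    · rw [hasWeakDeriv_iff_fourier, hF]
      have h3 : (𝓕 (-φ) : L2R) = -𝓕 φ := map_neg (Lp.fourierTransformₗᵢ ℝ ℂ) φ
      rw [h3]
      filter_upwards [h, hmem.coeFn_toLp, Lp.coeFn_neg (𝓕 φ : L2R)] with ξ k₁ k₂ k₃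
      rw [k₃, Pi.neg_apply, k₁, k₂]
      push_cast
      linear_combination (-(4 * Real.pi ^ 2 * ξ ^ 2 * (𝓕 ψ : L2R) ξ)) * Complex.I_sq
    · rw [Lp.zero_smul, add_zero, neg_neg]

theorem exists_isUnitaryGroup_free : ∃ U : ℝ → L2R →L[ℂ] L2R, IsUnitaryGroup (schrodingerOp 0) U := by
  let q : ℝ → ℝ := fun ξ => (2 * Real.pi * ξ) ^ 2
  obtain ⟨M, hM⟩ := exists_phase_group (q := q) (by fun_prop)
  obtain ⟨h0, hadd, hnorm, hcont, hgen⟩ := phase_group_props hM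
  let T : L2R ≃ₗᵢ[ℂ] L2R := Lp.fourierTransformₗᵢ ℝ ℂ
  refine ⟨fun t => (T.symm : L2R →L[ℂ] L2R).comp ((M t).comp (T : L2R →L[ℂ] L2R)), ?_, ?_, ?_, ?_, ?_⟩
  · ext f : 1
    simp [h0]
  · intro s t
    ext f : 1
    simp [hadd]
  · intro t f
    simp [hnorm]
  · intro f
    exact T.symm.continuous.comp (hcont (T f))
  · intro ψ φ
    rw [mem_graph_free]
    refine (hgen (T ψ) (T φ)).trans ?_
    constructor
    · intro h
      have := ((T.symm : L2R →L[ℂ] L2R).restrictScalars ℝ).hasFDerivAt.comp_hasDerivAt 0 h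
      refine this.congr_deriv ?_
      change T.symm (-(Complex.I • T φ)) = _
      rw [map_neg, map_smul, T.symm_apply_apply]
    · intro h
      have := ((T : L2R →L[ℂ] L2R).restrictScalars ℝ).hasFDerivAt.comp_hasDerivAt 0 h
      refine (this.congr_deriv (g' := -(Complex.I • T φ)) ?_).congr_of_eventuallyEq
        (Eventually.of_forall fun t => ?_)
      · change T (-(Complex.I • φ)) = _
        rw [map_neg, map_smul]
      · exact (T.apply_symm_apply _).symm

theorem dense_sobolevH2 : Dense (sobolevH2 : Set L2R) := by
  refine (SchwartzMap.denseRange_toLpCLM (E := ℝ) (F := ℂ) (μ := volume) (p := 2)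
    ENNReal.ofNat_ne_top).mono ?_
  rintro _ ⟨f, rfl⟩
  have h : ∀ f : 𝓢(ℝ, ℂ), HasWeakDeriv (f.toLp 2) ((∂_{(1 : ℝ)} f).toLp 2) := by
    intro f
    unfold HasWeakDeriv
    rw [Lp.toTemperedDistribution_toLp_eq, Lp.toTemperedDistribution_toLp_eq,
      TemperedDistribution.lineDerivOp_toTemperedDistributionCLM_eq]
  exact ⟨_, _, h f, h _⟩

theorem existsUnique_isUnitaryGroup (V : Lp ℝ ∞ (volume : Measure ℝ)) :
    ∃! U : ℝ → L2R →L[ℂ] L2R, IsUnitaryGroup (schrodingerOp V) U := by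
  obtain ⟨U₀, h₀⟩ := exists_isUnitaryGroup_free
  let B : L2R →L[ℂ] L2R := LinearMap.mkContinuous ⟨⟨fun f => V • f, fun f g => Lp.add_smul V f g⟩,
    fun c f => lpSMul_smul V c f⟩ ‖V‖ fun f => Lp.norm_smul_le V f
  have hB : ∀ x y : L2R, inner ℂ (B x) y = inner ℂ x (B y) := by
    intro x y
    change inner ℂ (V • x : L2R) y = inner ℂ x (V • y : L2R)
    rw [L2.inner_def, L2.inner_def]
    refine integral_congr_ae ?_
    filter_upwards [Lp.coeFn_lpSMul (r := 2) V x, Lp.coeFn_lpSMul (r := 2) V y] with ξ h1 h2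
    rw [h1, h2]
    simp [mul_comm, mul_assoc]
  have hA : ∀ ψ φ : L2R, (ψ, φ) ∈ (schrodingerOp V).graph ↔
      (ψ, φ - B ψ) ∈ (schrodingerOp 0).graph := by
    intro ψ φ
    rw [mem_graph_schrodingerOp, mem_graph_schrodingerOp]
    refine exists_congr fun ψ₁ => exists_congr fun ψ₂ => and_congr_right fun _ =>
      and_congr_right fun _ => ?_
    rw [Lp.zero_smul, add_zero, sub_eq_iff_eq_add]
    rfl
  obtain ⟨U, hU⟩ := exists_isUnitaryGroup_of_bounded_perturbation h₀ B hB hA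
  exact ⟨U, hU, fun W hW => hW.unique dense_sobolevH2 hU⟩

/-- The unitary group `e^{-iHt}` of the Schrödinger operator `H = -d²/dx² + V`: the unique strongly
continuous one-parameter unitary group on `L²(ℝ)` with generator `-iH`. -/
noncomputable def evolution (V : Lp ℝ ∞ (volume : Measure ℝ)) : ℝ → L2R →L[ℂ] L2R :=
  (existsUnique_isUnitaryGroup V).choose

theorem isUnitaryGroup_evolution (V : Lp ℝ ∞ (volume : Measure ℝ)) :
    IsUnitaryGroup (schrodingerOp V) (evolution V) :=
  (existsUnique_isUnitaryGroup V).choose_spec.1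

end

end Schrodinger

/-!
Write `u t = e^{-iHt} ψ`. Formally, `m t = ‖x² (u t)‖` satisfies
`(m²)' = ⟨u, i[H, x⁴] u⟩ ≤ 8 m ‖x u'‖`, because the real potential commutes with `x⁴`, and an
integration by parts gives `‖x u'‖² ≤ 2 ‖x u'‖ ‖u‖ + m ‖u''‖`. Since `‖u‖`, `‖H u‖` are conserved and
`V` is bounded, `‖u‖` and `‖u''‖` stay below a constant multiple `L` of
`(‖ψ‖_{H²}² + ‖X² ψ‖²)^{1/2}`, which also dominates `m 0`. Hence
`m' ≤ C (L + (L m)^{1/2})`, so `(m² + L²)^{1/4}` grows at most linearly in `t`, which bounds `m` by a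
multiple of `L (1 + t²)`.

To make this rigorous, `x²` is replaced by the bounded smooth weight `x² / (1 + (δx)²)`. Its
derivative is bounded by twice its square root and its second derivative by `10`, both uniformly in
`δ`, so that the two inequalities (`abs_re_inner_generator_le` and `norm_sq_mulCLM_deriv_le`) and
the differential inequality (`sqrt_le_of_abs_deriv_le`) hold with constants independent of `δ`.
Fatou's lemma as `δ → 0` (`exists_norm_positionSq_le`) then yields both the invariance of the domain
of `X²` and the bound.
-/

namespace Schrodinger

open Filter Topology SchwartzMap

/-! ### Multiplication operators, integration by parts and the product rule -/

/-- Multiplication by a bounded real function, as a bounded operator on `L²(ℝ)`. -/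
noncomputable def mulCLM (W : Lp ℝ ∞ (volume : Measure ℝ)) : L2R →L[ℂ] L2R :=
  LinearMap.mkContinuous ⟨⟨fun f => W • f, fun f g => Lp.add_smul W f g⟩,
    fun c f => lpSMul_smul W c f⟩ ‖W‖ fun f => Lp.norm_smul_le W f

theorem mulCLM_apply (W : Lp ℝ ∞ (volume : Measure ℝ)) (f : L2R) : mulCLM W f = W • f := rfl

theorem coeFn_mulCLM (W : Lp ℝ ∞ (volume : Measure ℝ)) (f : L2R) :
    mulCLM W f =ᵐ[volume] fun x => (W x : ℂ) * f x := by
  filter_upwards [Lp.coeFn_lpSMul (r := 2) W f] with x h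
  rw [mulCLM_apply, h, Pi.smul_apply', Complex.real_smul]

theorem norm_mulCLM_apply_le (W : Lp ℝ ∞ (volume : Measure ℝ)) (f : L2R) :
    ‖mulCLM W f‖ ≤ ‖W‖ * ‖f‖ :=
  Lp.norm_smul_le W f

theorem inner_mulCLM_left (W : Lp ℝ ∞ (volume : Measure ℝ)) (f g : L2R) :
    inner ℂ (mulCLM W f) g = inner ℂ f (mulCLM W g) := by
  rw [L2.inner_def, L2.inner_def]
  refine integral_congr_ae ?_
  filter_upwards [coeFn_mulCLM W f, coeFn_mulCLM W g] with x h1 h2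
  rw [h1, h2]
  simp [mul_comm, mul_assoc]

theorem mulCLM_comm (V W : Lp ℝ ∞ (volume : Measure ℝ)) (f : L2R) :
    mulCLM V (mulCLM W f) = mulCLM W (mulCLM V f) := by
  refine Lp.ext ?_
  filter_upwards [coeFn_mulCLM V (mulCLM W f), coeFn_mulCLM W f, coeFn_mulCLM W (mulCLM V f),
    coeFn_mulCLM V f] with x h1 h2 h3 h4
  rw [h1, h2, h3, h4]
  ring

/-- Integration by parts in `H¹(ℝ)`, by Plancherel. -/
theorem HasWeakDeriv.inner_right_eq_neg {f f' g g' : L2R} (hf : HasWeakDeriv f f')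
    (hg : HasWeakDeriv g g') : inner ℂ f g' = -inner ℂ f' g := by
  open FourierTransform in
  have hF : ∀ u v : L2R, inner ℂ u v = inner ℂ (𝓕 u : L2R) (𝓕 v : L2R) := fun u v =>
    ((Lp.fourierTransformₗᵢ ℝ ℂ).inner_map_map u v).symm
  rw [hF f, hF f', L2.inner_def, L2.inner_def, ← integral_neg]
  refine integral_congr_ae ?_
  filter_upwards [hasWeakDeriv_iff_fourier.1 hf, hasWeakDeriv_iff_fourier.1 hg] with ξ h1 h2
  rw [h1, h2]
  simp only [RCLike.inner_apply, map_mul, Complex.conj_I, Complex.conj_ofReal, map_ofNat]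
  ring

theorem integrable_schwartz_mul (φ : 𝓢(ℝ, ℂ)) (f : L2R) : Integrable fun x => φ x * f x :=
  (φ.memLp 2 volume).integrable_mul (Lp.memLp f)

/-- The product rule for a bounded factor `b` with bounded derivative. Temperate growth of `b` makes
`b φ` a Schwartz function for each Schwartz test function `φ`. -/
theorem HasWeakDeriv.bounded_mul {b b' : ℝ → ℝ} (hb : b.HasTemperateGrowth)
    (hd : ∀ x, HasDerivAt b (b' x) x) {W W' : Lp ℝ ∞ (volume : Measure ℝ)}
    (hW : W =ᵐ[volume] b) (hW' : W' =ᵐ[volume] b') {f f' : L2R} (hf : HasWeakDeriv f f') :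
    HasWeakDeriv (mulCLM W f) (mulCLM W' f + mulCLM W f') := by
  rw [hasWeakDeriv_iff] at hf ⊢
  intro φ
  have hbc : (fun x => (b x : ℂ)).HasTemperateGrowth := by fun_prop
  set χ : 𝓢(ℝ, ℂ) := smulLeftCLM ℂ (fun x => (b x : ℂ)) φ
  have hχ : ∀ x, χ x = b x * φ x := fun x => by
    simp [χ, smulLeftCLM_apply_apply hbc]
  have hχd : ∀ x, deriv χ x = b' x * φ x + b x * deriv φ x := by
    intro x
    have h1 : HasDerivAt (fun x => (b x : ℂ) * φ x) (b' x * φ x + b x * deriv φ x) x :=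
      (hd x).ofReal_comp.mul (φ.differentiable.differentiableAt.hasDerivAt)
    rw [show (χ : ℝ → ℂ) = fun x => (b x : ℂ) * φ x from funext hχ]
    exact h1.deriv
  have h1 : ∫ x, φ x * (mulCLM W' f + mulCLM W f') x =
      (∫ x, φ x * (mulCLM W' f) x) + ∫ x, χ x * f' x := by
    rw [← integral_add (integrable_schwartz_mul _ _) (integrable_schwartz_mul _ _)]
    refine integral_congr_ae ?_
    filter_upwards [Lp.coeFn_add (mulCLM W' f) (mulCLM W f'), coeFn_mulCLM W f', hW] with x k1 k2 k3
    rw [k1, Pi.add_apply, k2, k3, hχ]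
    ring
  have h2 : ∫ x, deriv χ x * f x =
      (∫ x, φ x * (mulCLM W' f) x) + ∫ x, deriv φ x * (mulCLM W f) x := by
    have h3 := integrable_schwartz_mul (SchwartzMap.derivCLM ℂ ℂ φ) (mulCLM W f)
    simp only [SchwartzMap.derivCLM_apply] at h3
    rw [← integral_add (integrable_schwartz_mul _ _) h3]
    refine integral_congr_ae ?_
    filter_upwards [coeFn_mulCLM W f, coeFn_mulCLM W' f, hW, hW'] with x k1 k2 k3 k4
    rw [k1, k2, k3, k4, hχd]
    ring
  rw [h1, hf χ, h2]
  ring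

theorem norm_mulCLM_apply_le_of_ae_le {W : Lp ℝ ∞ (volume : Measure ℝ)} {c : ℝ}
    (h : ∀ᵐ x, |W x| ≤ c) (f : L2R) : ‖mulCLM W f‖ ≤ c * ‖f‖ := by
  refine Lp.norm_le_mul_norm_of_ae_le_mul ?_
  filter_upwards [h, coeFn_mulCLM W f] with x h1 h2
  rw [h2, norm_mul, Complex.norm_real]
  exact mul_le_mul_of_nonneg_right h1 (norm_nonneg _)

/-! ### The commutator estimate and the interpolation inequality -/

/-- The rate of change of `‖w u‖²` along the flow, up to a factor `2`: the terms `V` and `w u'`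
contribute purely imaginary numbers, which leaves only the commutator with the derivative `w₁` of
the weight `w`. -/
theorem abs_re_inner_generator_le {V W W₁ : Lp ℝ ∞ (volume : Measure ℝ)} {w w₁ : ℝ → ℝ}
    (hw : w.HasTemperateGrowth) (hd : ∀ x, HasDerivAt w (w₁ x) x)
    (hW : W =ᵐ[volume] w) (hW₁ : W₁ =ᵐ[volume] w₁) {ψ ψ₁ ψ₂ : L2R}
    (h₁ : HasWeakDeriv ψ ψ₁) (h₂ : HasWeakDeriv ψ₁ ψ₂) :
    |(inner ℂ (mulCLM W ψ) (mulCLM W (-(Complex.I • (-ψ₂ + V • ψ))))).re| ≤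
      2 * (‖mulCLM W ψ‖ * ‖mulCLM W₁ ψ₁‖) := by
  have key : inner ℂ (mulCLM W ψ) (mulCLM W ψ₂) =
      -(2 * inner ℂ (mulCLM W ψ) (mulCLM W₁ ψ₁) + inner ℂ (mulCLM W ψ₁) (mulCLM W ψ₁)) := by
    rw [← inner_mulCLM_left, ((h₁.bounded_mul hw hd hW hW₁).bounded_mul hw hd hW
      hW₁).inner_right_eq_neg h₂, map_add, inner_add_left, inner_add_left, mulCLM_comm W W₁,
      inner_mulCLM_left W₁, inner_mulCLM_left W (mulCLM W ψ₁)]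
    ring
  have hV : (inner ℂ (mulCLM W ψ) (mulCLM W (V • ψ))).im = 0 := by
    rw [← mulCLM_apply, mulCLM_comm W V, ← Complex.conj_eq_iff_im, inner_conj_symm,
      inner_mulCLM_left]
  have hr : (inner ℂ (mulCLM W ψ₁) (mulCLM W ψ₁)).im = 0 := by
    rw [← Complex.conj_eq_iff_im, inner_conj_symm]
  have e : (inner ℂ (mulCLM W ψ) (mulCLM W (-(Complex.I • (-ψ₂ + V • ψ))))).re =
      2 * (inner ℂ (mulCLM W ψ) (mulCLM W₁ ψ₁)).im := by
    rw [map_neg, map_smul, map_add, map_neg, inner_neg_right, inner_smul_right, inner_add_right,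
      inner_neg_right, key]
    simp [hV, ← Complex.ofReal_pow]
  rw [e, abs_mul, abs_two]
  gcongr
  exact (Complex.abs_im_le_norm _).trans (norm_inner_le_norm _ _)

/-- Weighted interpolation of `ψ'` between `ψ` and `ψ''`, for `w₁ = O(|w|^{1/2})` with bounded
derivative: integrate `∫ w₁² |ψ'|²` by parts. -/
theorem norm_sq_mulCLM_deriv_le {W W₁ W₂ : Lp ℝ ∞ (volume : Measure ℝ)} {w₁ w₂ : ℝ → ℝ} {a b : ℝ}
    (hw : w₁.HasTemperateGrowth) (hd : ∀ x, HasDerivAt w₁ (w₂ x) x)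
    (hW₁ : W₁ =ᵐ[volume] w₁) (hW₂ : W₂ =ᵐ[volume] w₂)
    (ha : ∀ᵐ x, |W₂ x| ≤ a) (hb : ∀ᵐ x, W₁ x ^ 2 ≤ b * |W x|) {ψ ψ₁ ψ₂ : L2R}
    (h₁ : HasWeakDeriv ψ ψ₁) (h₂ : HasWeakDeriv ψ₁ ψ₂) :
    ‖mulCLM W₁ ψ₁‖ ^ 2 ≤
      2 * a * ‖mulCLM W₁ ψ₁‖ * ‖ψ‖ + b * ‖mulCLM W ψ‖ * ‖ψ₂‖ := by
  have key : inner ℂ (mulCLM W₁ ψ₁) (mulCLM W₁ ψ₁) =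
      -(2 * inner ℂ (mulCLM W₁ ψ₁) (mulCLM W₂ ψ) + inner ℂ ψ₂ (mulCLM W₁ (mulCLM W₁ ψ))) := by
    rw [← inner_mulCLM_left, ((h₂.bounded_mul hw hd hW₁ hW₂).bounded_mul hw hd hW₁
      hW₂).inner_right_eq_neg h₁, map_add, inner_add_left, inner_add_left, mulCLM_comm W₁ W₂,
      inner_mulCLM_left W₂, inner_mulCLM_left W₁ (mulCLM W₁ ψ₂), inner_mulCLM_left W₁ ψ₂]
    ring
  have hb' : ‖mulCLM W₁ (mulCLM W₁ ψ)‖ ≤ b * ‖mulCLM W ψ‖ := by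
    refine Lp.norm_le_mul_norm_of_ae_le_mul ?_
    filter_upwards [hb, coeFn_mulCLM W₁ ψ, coeFn_mulCLM W₁ (mulCLM W₁ ψ), coeFn_mulCLM W ψ]
      with x k1 k2 k3 k4
    rw [k3, k2, k4, ← mul_assoc, norm_mul, norm_mul, norm_mul, Complex.norm_real,
      Complex.norm_real, ← mul_assoc, Real.norm_eq_abs, Real.norm_eq_abs, abs_mul_abs_self,
      ← pow_two]
    exact mul_le_mul_of_nonneg_right k1 (norm_nonneg _)
  calc ‖mulCLM W₁ ψ₁‖ ^ 2 = ‖inner ℂ (mulCLM W₁ ψ₁) (mulCLM W₁ ψ₁)‖ := by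
        rw [inner_self_eq_norm_sq_to_K]; simp
    _ ≤ 2 * (‖mulCLM W₁ ψ₁‖ * (a * ‖ψ‖)) + ‖ψ₂‖ * (b * ‖mulCLM W ψ‖) := by
        rw [key, norm_neg]
        refine (norm_add_le _ _).trans (add_le_add ?_ ?_)
        · rw [norm_mul, Complex.norm_ofNat]
          gcongr
          refine (norm_inner_le_norm _ _).trans ?_
          gcongr
          exact norm_mulCLM_apply_le_of_ae_le ha ψ
        · refine (norm_inner_le_norm _ _).trans ?_
          gcongr
    _ = _ := by ring

/-! ### The differential inequality -/

/-- A Gronwall-type bound. With `m = √F`, the hypotheses read `(m²)' ≤ 4 m K` and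
`K² ≤ 20 L K + 4 L m`, so that `m' = O(L + (L m)^{1/2})` and `m` grows at most quadratically. -/
theorem sqrt_le_of_abs_deriv_le {F D K : ℝ → ℝ} {L : ℝ} (hL : 0 < L) (hF : ∀ t, 0 ≤ F t)
    (hF₀ : F 0 ≤ L ^ 2) (hd : ∀ t, HasDerivAt F (D t) t)
    (hD : ∀ t, |D t| ≤ 4 * √(F t) * K t)
    (hK : ∀ t, K t ^ 2 ≤ 20 * L * K t + 4 * L * √(F t)) (t : ℝ) :
    √(F t) ≤ 968 * L * (1 + t ^ 2) := by
  -- `G = (m² + L²)^{1/4}` is comparable to `(m + L)^{1/2}`, whose derivative is bounded, and, unlike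
  -- the latter, it is differentiable where `F` vanishes.
  set G : ℝ → ℝ := fun t => √√(F t + L ^ 2) with hG
  have hp : ∀ t, 0 < F t + L ^ 2 := fun t => by have := hF t; positivity
  have hGp : ∀ t, 0 < G t := fun t => Real.sqrt_pos.2 (Real.sqrt_pos.2 (hp t))
  have hG2 : ∀ t, G t ^ 2 = √(F t + L ^ 2) := fun t => Real.sq_sqrt (Real.sqrt_nonneg _)
  have hFG : ∀ t, √(F t) ≤ G t ^ 2 := fun t => by
    rw [hG2]; exact Real.sqrt_le_sqrt (by nlinarith)
  set l := √L with hl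
  have hlp : 0 < l := Real.sqrt_pos.2 hL
  have hl2 : l ^ 2 = L := Real.sq_sqrt hL.le
  have hlG : ∀ t, l ≤ G t := fun t => by
    refine Real.sqrt_le_sqrt ?_
    exact Real.le_sqrt_of_sq_le (by linarith [hF t])
  have hKG : ∀ t, K t ≤ 22 * l * G t := fun t => by
    by_contra! hcon
    have h1 := hK t
    have h2 : L ≤ l * G t := by rw [← hl2, pow_two]; exact mul_le_mul_of_nonneg_left (hlG t) hlp.le
    have h3 : L * √(F t) ≤ (l * G t) ^ 2 := by
      rw [mul_pow, hl2]; exact mul_le_mul_of_nonneg_left (hFG t) hL.le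
    have h4 : 0 < l * G t := mul_pos hlp (hGp t)
    have h5 : 0 < K t := by linarith [mul_pos (mul_pos (by norm_num : (0:ℝ) < 22) hlp) (hGp t)]
    nlinarith [mul_le_mul_of_nonneg_right h2 h5.le, mul_pos h4 h4]
  have hGd : ∀ t, HasDerivAt G (D t / (2 * √(F t + L ^ 2)) / (2 * √√(F t + L ^ 2))) t := fun t =>
    (((hd t).add_const _).sqrt (hp t).ne').sqrt (Real.sqrt_pos.2 (hp t)).ne'
  have hGb : ∀ t, ‖deriv G t‖ ≤ 22 * l := fun t => by
    rw [(hGd t).deriv, show √√(F t + L ^ 2) = G t from rfl, ← hG2, Real.norm_eq_abs, abs_div,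
      abs_div, abs_of_pos (show 0 < 2 * G t by linarith [hGp t]),
      abs_of_pos (show 0 < 2 * G t ^ 2 by have := hGp t; positivity), div_div,
      div_le_iff₀ (by have := hGp t; positivity)]
    calc |D t| ≤ 4 * √(F t) * K t := hD t
      _ ≤ 4 * √(F t) * (22 * l * G t) := by gcongr; exact hKG t
      _ ≤ 4 * G t ^ 2 * (22 * l * G t) := by
        have := hGp t
        gcongr
        exact hFG t
      _ = _ := by ring
  have hlip : G t - G 0 ≤ 22 * l * |t| := by
    have := convex_univ.norm_image_sub_le_of_norm_deriv_le (f := G) (x := 0) (y := t)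
      (fun x _ => (hGd x).differentiableAt) (fun x _ => hGb x) trivial trivial
    rw [sub_zero, Real.norm_eq_abs, Real.norm_eq_abs] at this
    exact (le_abs_self _).trans this
  have hG0 : G 0 ≤ 2 * l := by
    refine (Real.sqrt_le_left (by positivity)).2 ((Real.sqrt_le_left (by positivity)).2 ?_)
    rw [mul_pow, hl2]
    nlinarith
  have h1 : G t ≤ l * (2 + 22 * |t|) := by linarith
  calc √(F t) ≤ G t ^ 2 := hFG t
    _ ≤ (l * (2 + 22 * |t|)) ^ 2 := by have := hGp t; gcongr
    _ = L * (4 + 88 * |t| + 484 * t ^ 2) := by rw [mul_pow, hl2, ← sq_abs t]; ring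
    _ ≤ L * (968 * (1 + t ^ 2)) := by
        gcongr
        nlinarith [sq_nonneg (|t| - 1), sq_abs t]
    _ = _ := by ring

/-! ### Invariance of the domain of the generator -/

theorem IsUnitaryGroup.graph_and_hasDerivAt {E : Type*} [NormedAddCommGroup E]
    [InnerProductSpace ℂ E] {A : E →ₗ.[ℂ] E} {U : ℝ → E →L[ℂ] E} (hU : IsUnitaryGroup A U)
    {ψ φ : E} (h : (ψ, φ) ∈ A.graph) (t : ℝ) :
    (U t ψ, U t φ) ∈ A.graph ∧ HasDerivAt (fun t => U t ψ) (-(Complex.I • U t φ)) t := by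
  have h1 := ((U t).restrictScalars ℝ).hasFDerivAt.comp_hasDerivAt 0 ((hU.generator _ _).1 h)
  simp only [ContinuousLinearMap.coe_restrictScalars', map_neg, map_smul] at h1
  constructor
  · rw [hU.generator]
    refine h1.congr_of_eventuallyEq (Eventually.of_forall fun s => ?_)
    change U s (U t ψ) = U t (U s ψ)
    rw [← mul_apply_eq_comp, ← mul_apply_eq_comp, ← hU.add, ← hU.add, add_comm]
  · have h2 : HasDerivAt (fun s => U t (U s ψ)) (-(Complex.I • U t φ)) (t - t) := by
      rw [sub_self]; exact h1
    refine (h2.comp_sub_const t t).congr_of_eventuallyEq (Eventually.of_forall fun s => ?_)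
    change U s ψ = U t (U (s - t) ψ)
    rw [← mul_apply_eq_comp, ← hU.add, add_sub_cancel]

/-! ### The regularized weight -/

/-- The factor `1 / (1 + (δx)²)`, which tends to `1` as `δ → 0`. -/
noncomputable def cutoff (δ x : ℝ) : ℝ := (1 + (δ * x) ^ 2)⁻¹

/-- The regularization `x² / (1 + (δx)²)` of `x²`, bounded for `δ ≠ 0`. -/
noncomputable def weight (δ x : ℝ) : ℝ := x ^ 2 * cutoff δ x

/-- The derivative `2x / (1 + (δx)²)²` of `weight δ`. -/
noncomputable def weightDeriv (δ x : ℝ) : ℝ := 2 * x * cutoff δ x ^ 2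

/-- The second derivative of `weight δ`. -/
noncomputable def weightDeriv₂ (δ x : ℝ) : ℝ :=
  2 * cutoff δ x ^ 2 - 8 * ((δ * x) ^ 2 * cutoff δ x) * cutoff δ x ^ 2

theorem hasTemperateGrowth_cutoff (δ : ℝ) : (cutoff δ).HasTemperateGrowth := by
  have h := (Function.hasTemperateGrowth_one_add_norm_sq_rpow ℝ (-1)).comp
    (f := fun x : ℝ => δ * x) (by fun_prop)
  refine (congrArg Function.HasTemperateGrowth (funext fun x => ?_)).mp h
  simp [cutoff, Real.rpow_neg_one]

theorem hasTemperateGrowth_weight (δ : ℝ) : (weight δ).HasTemperateGrowth := by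
  have := hasTemperateGrowth_cutoff δ
  unfold weight
  fun_prop

theorem hasTemperateGrowth_weightDeriv (δ : ℝ) : (weightDeriv δ).HasTemperateGrowth := by
  have := hasTemperateGrowth_cutoff δ
  unfold weightDeriv
  fun_prop

theorem cutoff_pos (δ x : ℝ) : 0 < cutoff δ x := by
  unfold cutoff; positivity

theorem sq_mul_cutoff (δ x : ℝ) : (δ * x) ^ 2 * cutoff δ x = 1 - cutoff δ x := by
  have : (1 + (δ * x) ^ 2) ≠ 0 := by positivity
  rw [cutoff]
  field_simp
  ring

theorem cutoff_le_one (δ x : ℝ) : cutoff δ x ≤ 1 :=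
  inv_le_one_of_one_le₀ (by nlinarith [sq_nonneg (δ * x)])

theorem hasDerivAt_cutoff (δ x : ℝ) :
    HasDerivAt (cutoff δ) (-(2 * δ ^ 2 * x * cutoff δ x ^ 2)) x := by
  have h0 : (1 + (δ * x) ^ 2) ≠ 0 := by positivity
  have h := ((((hasDerivAt_id x).const_mul δ).pow 2).const_add 1).inv h0
  refine h.congr_deriv ?_
  change -(((2 : ℕ) : ℝ) * (δ * x) ^ 1 * (δ * 1)) / (1 + (δ * x) ^ 2) ^ 2 = _
  rw [cutoff, inv_pow, ← div_eq_mul_inv]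
  push_cast
  ring

theorem hasDerivAt_weight (δ x : ℝ) : HasDerivAt (weight δ) (weightDeriv δ x) x := by
  refine ((hasDerivAt_pow 2 x).mul (hasDerivAt_cutoff δ x)).congr_deriv ?_
  rw [weightDeriv]
  linear_combination (exp := 1) (-2 * x * cutoff δ x) * sq_mul_cutoff δ x

theorem hasDerivAt_weightDeriv (δ x : ℝ) : HasDerivAt (weightDeriv δ) (weightDeriv₂ δ x) x := by
  refine (((hasDerivAt_id x).const_mul 2).mul ((hasDerivAt_cutoff δ x).pow 2)).congr_deriv ?_
  simp only [weightDeriv₂, id, Pi.pow_apply]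
  push_cast
  ring

theorem abs_weight (δ x : ℝ) : |weight δ x| = weight δ x :=
  abs_of_nonneg (mul_nonneg (sq_nonneg _) (cutoff_pos δ x).le)

theorem weight_le_sq (δ x : ℝ) : weight δ x ≤ x ^ 2 :=
  mul_le_of_le_one_right (sq_nonneg x) (cutoff_le_one δ x)

theorem weight_le {δ : ℝ} (hδ : 0 < δ) (x : ℝ) : weight δ x ≤ (δ ^ 2)⁻¹ := by
  rw [← one_div, le_div_iff₀ (by positivity), weight]
  have h1 := sq_mul_cutoff δ x
  have h2 := cutoff_pos δ x
  nlinarith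

theorem weightDeriv_sq_le (δ x : ℝ) : weightDeriv δ x ^ 2 ≤ 4 * weight δ x := by
  have h : cutoff δ x ^ 4 ≤ cutoff δ x :=
    pow_le_of_le_one (cutoff_pos δ x).le (cutoff_le_one δ x) (by norm_num)
  rw [weightDeriv, weight]
  nlinarith [mul_le_mul_of_nonneg_left h (sq_nonneg x)]

theorem abs_weightDeriv₂_le (δ x : ℝ) : |weightDeriv₂ δ x| ≤ 10 := by
  have h0 := cutoff_pos δ x
  have h1 := cutoff_le_one δ x
  have h2 : cutoff δ x ^ 2 ≤ 1 := pow_le_one₀ h0.le h1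
  have h3 := pow_pos h0 2
  have h4 := pow_pos h0 3
  rw [weightDeriv₂, sq_mul_cutoff, abs_le]
  constructor <;> nlinarith

theorem exists_weights {δ : ℝ} (hδ : 0 < δ) : ∃ W W₁ W₂ : Lp ℝ ∞ (volume : Measure ℝ),
    W =ᵐ[volume] weight δ ∧ W₁ =ᵐ[volume] weightDeriv δ ∧ W₂ =ᵐ[volume] weightDeriv₂ δ := by
  have hc : Continuous (cutoff δ) := (hasTemperateGrowth_cutoff δ).1.continuous
  have h : MemLp (weight δ) ∞ volume :=
    memLp_top_of_bound (hasTemperateGrowth_weight δ).1.continuous.aestronglyMeasurable (δ ^ 2)⁻¹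
      (ae_of_all _ fun x => by rw [Real.norm_eq_abs, abs_weight]; exact weight_le hδ x)
  have h₁ : MemLp (weightDeriv δ) ∞ volume :=
    memLp_top_of_bound (hasTemperateGrowth_weightDeriv δ).1.continuous.aestronglyMeasurable
      (1 + 4 * (δ ^ 2)⁻¹) (ae_of_all _ fun x => by
        rw [Real.norm_eq_abs]
        nlinarith [weightDeriv_sq_le δ x, weight_le hδ x, sq_abs (weightDeriv δ x),
          sq_nonneg (|weightDeriv δ x| - 1)])
  have h₂ : MemLp (weightDeriv₂ δ) ∞ volume :=
    memLp_top_of_bound (Continuous.aestronglyMeasurable (by unfold weightDeriv₂; fun_prop)) 10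
      (ae_of_all _ fun x => abs_weightDeriv₂_le δ x)
  exact ⟨h.toLp, h₁.toLp, h₂.toLp, h.coeFn_toLp, h₁.coeFn_toLp, h₂.coeFn_toLp⟩

/-! ### The regularized bound and its limit -/

/-- The quadratic bound for the regularized weight, with a constant independent of `δ`. -/
theorem norm_mulCLM_evolution_le {V W : Lp ℝ ∞ (volume : Measure ℝ)} {δ L : ℝ} (hδ : 0 < δ)
    (hW : W =ᵐ[volume] weight δ) (hL : 0 < L) {ψ φ : L2R} (h : (ψ, φ) ∈ (schrodingerOp V).graph)
    (hψ : ‖ψ‖ ≤ L) (hφ : ‖φ‖ + ‖V‖ * ‖ψ‖ ≤ L) (hWψ : ‖mulCLM W ψ‖ ≤ L) (t : ℝ) :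
    ‖mulCLM W (evolution V t ψ)‖ ≤ 968 * L * (1 + t ^ 2) := by
  have hU := isUnitaryGroup_evolution V
  obtain ⟨_, W₁, W₂, -, hW₁, hW₂⟩ := exists_weights hδ
  choose ψ₁ ψ₂ h₁ h₂ h₃ using fun t => mem_graph_schrodingerOp.1 (hU.graph_and_hasDerivAt h t).1
  -- `ψ₂ t` is the second derivative of the state at time `t`, controlled through the equation.
  have hψ₂ : ∀ t, ‖ψ₂ t‖ ≤ L := fun t => by
    have : ψ₂ t = V • evolution V t ψ - evolution V t φ := by rw [h₃ t]; abel
    calc ‖ψ₂ t‖ ≤ ‖mulCLM V (evolution V t ψ)‖ + ‖evolution V t φ‖ := by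
          rw [this]; exact norm_sub_le _ _
      _ ≤ ‖V‖ * ‖ψ‖ + ‖φ‖ := by
          rw [hU.norm_map]
          gcongr
          exact (norm_mulCLM_apply_le _ _).trans_eq (by rw [hU.norm_map])
      _ ≤ L := by linarith
  have hd : ∀ t, HasDerivAt (fun t => ‖mulCLM W (evolution V t ψ)‖ ^ 2)
      (2 * (inner ℂ (mulCLM W (evolution V t ψ))
        (mulCLM W (-(Complex.I • evolution V t φ)))).re) t := fun t => by
    have k1 := ((mulCLM W).restrictScalars ℝ).hasFDerivAt.comp_hasDerivAt t
      (hU.graph_and_hasDerivAt h t).2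
    have k2 := Complex.reCLM.hasFDerivAt.comp_hasDerivAt t (k1.inner ℂ k1)
    refine (k2.congr_deriv ?_).congr_of_eventuallyEq (Eventually.of_forall fun s => ?_)
    · simp only [Complex.reCLM_apply, Complex.add_re, two_mul, Function.comp_apply,
        ContinuousLinearMap.coe_restrictScalars']
      congr 1
      exact inner_re_symm (𝕜 := ℂ) _ _
    · change _ = Complex.re (inner ℂ _ _)
      rw [inner_self_eq_norm_sq_to_K]
      simp [← Complex.ofReal_pow]
  have := sqrt_le_of_abs_deriv_le hL (fun t => sq_nonneg _) ?_ hd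
    (K := fun t => ‖mulCLM W₁ (ψ₁ t)‖) (fun t => ?_) (fun t => ?_) t
  · rwa [Real.sqrt_sq (norm_nonneg _)] at this
  · rw [hU.zero]
    exact pow_le_pow_left₀ (norm_nonneg _) hWψ 2
  · rw [Real.sqrt_sq (norm_nonneg _), h₃ t, abs_mul, abs_two]
    have := abs_re_inner_generator_le (V := V) (hasTemperateGrowth_weight δ) (hasDerivAt_weight δ)
      hW hW₁ (h₁ t) (h₂ t)
    linarith
  · rw [Real.sqrt_sq (norm_nonneg _)]
    have := norm_sq_mulCLM_deriv_le (W := W) (a := 10) (b := 4) (hasTemperateGrowth_weightDeriv δ)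
      (hasDerivAt_weightDeriv δ) hW₁ hW₂
      (by filter_upwards [hW₂] with x hx; rw [hx]; exact abs_weightDeriv₂_le δ x)
      (by filter_upwards [hW, hW₁] with x hx hx'
          rw [hx, hx', abs_weight]; exact weightDeriv_sq_le δ x) (h₁ t) (h₂ t)
    rw [hU.norm_map] at this
    refine this.trans ?_
    have e1 := mul_le_mul_of_nonneg_left hψ (norm_nonneg (mulCLM W₁ (ψ₁ t)))
    have e2 := mul_le_mul_of_nonneg_left (hψ₂ t) (norm_nonneg (mulCLM W (evolution V t ψ)))
    linarith

theorem coeFn_positionSq (ψ : positionSq.domain) :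
    positionSq ψ =ᵐ[volume] fun x : ℝ => (x : ℂ) ^ 2 * (ψ : L2R) x :=
  MemLp.coeFn_toLp ψ.2

theorem norm_mulCLM_weight_le {W : Lp ℝ ∞ (volume : Measure ℝ)} {δ : ℝ}
    (hW : W =ᵐ[volume] weight δ) (ψ : positionSq.domain) :
    ‖mulCLM W (ψ : L2R)‖ ≤ ‖positionSq ψ‖ := by
  refine Lp.norm_le_norm_of_ae_le ?_
  filter_upwards [coeFn_mulCLM W (ψ : L2R), hW, coeFn_positionSq ψ] with x h1 h2 h3
  rw [h1, h2, h3, norm_mul, norm_mul, norm_pow, Complex.norm_real, Complex.norm_real,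
    Real.norm_eq_abs, abs_weight, Real.norm_eq_abs, sq_abs]
  gcongr
  exact weight_le_sq δ x

/-- A bound on the regularized weights that is uniform in `δ` puts `f` in the domain of `X²`, by
Fatou's lemma. -/
theorem exists_norm_positionSq_le {f : L2R} {M : ℝ}
    (h : ∀ δ > 0, ∀ W : Lp ℝ ∞ (volume : Measure ℝ), W =ᵐ[volume] weight δ → ‖mulCLM W f‖ ≤ M) :
    ∃ hf : f ∈ positionSq.domain, ‖positionSq ⟨f, hf⟩‖ ≤ M := by
  let δ : ℕ → ℝ := fun n => 1 / ((n : ℝ) + 1)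
  have hδ : ∀ n, 0 < δ n := fun n => by positivity
  choose W _ _ hW _ _ using fun n => exists_weights (hδ n)
  have hlim : ∀ᵐ x, Tendsto (fun n => mulCLM (W n) f x) atTop (𝓝 ((x : ℂ) ^ 2 * f x)) := by
    filter_upwards [ae_all_iff.2 hW, ae_all_iff.2 fun n => coeFn_mulCLM (W n) f] with x h1 h2
    simp only [h2, h1]
    refine Tendsto.mul_const _ ?_
    have hδ0 : Tendsto δ atTop (𝓝 0) := tendsto_one_div_add_atTop_nhds_zero_nat
    have hc : Continuous fun d : ℝ => (weight d x : ℂ) := by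
      unfold weight cutoff
      have : ∀ d : ℝ, 1 + (d * x) ^ 2 ≠ 0 := fun d => by positivity
      fun_prop (disch := assumption)
    have := (hc.tendsto 0).comp hδ0
    simpa [weight, cutoff, Function.comp_def] using this
  have hle : eLpNorm (fun x : ℝ => (x : ℂ) ^ 2 * f x) 2 volume ≤ ENNReal.ofReal M := by
    refine (Lp.eLpNorm_lim_le_liminf_eLpNorm (fun n => Lp.aestronglyMeasurable (mulCLM (W n) f)) _
      hlim).trans ?_
    refine liminf_le_of_le (by isBoundedDefault) fun b hb => ?_
    obtain ⟨n, hn⟩ := hb.exists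
    refine hn.trans ?_
    rw [← Lp.enorm_def, ← ofReal_norm]
    exact ENNReal.ofReal_le_ofReal (h (δ n) (hδ n) (W n) (hW n))
  have hmem : MemLp (fun x : ℝ => (x : ℂ) ^ 2 * f x) 2 volume :=
    ⟨(Continuous.aestronglyMeasurable (by fun_prop)).mul (Lp.aestronglyMeasurable f),
      hle.trans_lt ENNReal.ofReal_lt_top⟩
  have hM : 0 ≤ M := (norm_nonneg _).trans (h (δ 0) (hδ 0) (W 0) (hW 0))
  refine ⟨hmem, ?_⟩
  change ‖hmem.toLp‖ ≤ M
  rw [Lp.norm_toLp]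
  exact ENNReal.toReal_le_of_le_ofReal hM hle

end Schrodinger

theorem theorem5p2 (R : ℝ) (hR : 0 < R) :
    ∃ β : ℝ, ∀ V : Lp ℝ ∞ (volume : Measure ℝ), ‖V‖ ≤ R →
      ∀ (ψ : Schrodinger.L2R) (_ : ψ ∈ Schrodinger.sobolevH2)
        (hX : ψ ∈ Schrodinger.positionSq.domain) (t : ℝ),
        ∃ h : Schrodinger.evolution V t ψ ∈ Schrodinger.positionSq.domain,
          ‖Schrodinger.positionSq ⟨Schrodinger.evolution V t ψ, h⟩‖ ≤
            β * (1 + t ^ 2) *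
              Real.sqrt (Schrodinger.sobolevH2Norm ψ ^ 2 +
                ‖Schrodinger.positionSq ⟨ψ, hX⟩‖ ^ 2) := by
  open Schrodinger in
  refine ⟨968 * (1 + 2 * R), fun V hV ψ hψ hX t => ?_⟩
  obtain ⟨ψ₁, ψ₂, h₁, h₂⟩ := hψ
  set N := Real.sqrt (sobolevH2Norm ψ ^ 2 + ‖positionSq ⟨ψ, hX⟩‖ ^ 2) with hN
  have hN' : N = Real.sqrt (‖ψ‖ ^ 2 + ‖ψ₁‖ ^ 2 + ‖ψ₂‖ ^ 2 + ‖positionSq ⟨ψ, hX⟩‖ ^ 2) := by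
    rw [hN, sobolevH2Norm, Real.sq_sqrt (by positivity), h₁.weakDeriv_eq, h₂.weakDeriv_eq]
  have hN0 : ‖ψ‖ ≤ N := by
    rw [hN']
    exact Real.le_sqrt_of_sq_le (by
      nlinarith [sq_nonneg ‖ψ₁‖, sq_nonneg ‖ψ₂‖, sq_nonneg ‖positionSq ⟨ψ, hX⟩‖])
  have hN2 : ‖ψ₂‖ ≤ N := by
    rw [hN']
    exact Real.le_sqrt_of_sq_le (by
      nlinarith [sq_nonneg ‖ψ₁‖, sq_nonneg ‖ψ‖, sq_nonneg ‖positionSq ⟨ψ, hX⟩‖])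
  have hNX : ‖positionSq ⟨ψ, hX⟩‖ ≤ N := by
    rw [hN']
    exact Real.le_sqrt_of_sq_le (by
      nlinarith [sq_nonneg ‖ψ₁‖, sq_nonneg ‖ψ‖, sq_nonneg ‖ψ₂‖])
  have hNn : 0 ≤ N := Real.sqrt_nonneg _
  refine exists_norm_positionSq_le fun δ hδ W hW => ?_
  have hVψ : ‖V‖ * ‖ψ‖ ≤ R * N := by gcongr
  have hφ : ‖-ψ₂ + V • ψ‖ ≤ ‖ψ₂‖ + ‖V‖ * ‖ψ‖ := by
    refine (norm_add_le _ _).trans ?_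
    rw [norm_neg]
    gcongr
    exact norm_mulCLM_apply_le V ψ
  have hRN : 0 ≤ R * N := by positivity
  -- The bound with `L = (1 + 2R) N` is reached as a limit, since this number may be zero.
  have key : ∀ L, (1 + 2 * R) * N < L →
      ‖mulCLM W (evolution V t ψ)‖ ≤ 968 * L * (1 + t ^ 2) := fun L hL =>
    norm_mulCLM_evolution_le hδ hW (by nlinarith)
      (mem_graph_schrodingerOp.2 ⟨ψ₁, ψ₂, h₁, h₂, rfl⟩) (by nlinarith) (by nlinarith)
      ((norm_mulCLM_weight_le hW ⟨ψ, hX⟩).trans (by nlinarith)) t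
  have hc : Continuous fun L : ℝ => 968 * L * (1 + t ^ 2) := by fun_prop
  have := ge_of_tendsto ((hc.tendsto ((1 + 2 * R) * N)).mono_left nhdsWithin_le_nhds)
    (eventually_nhdsWithin_of_forall (s := Set.Ioi _) key)
  linarith
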